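/- Let $n,p\ge 1$, let $X\in\mathbb R^{n\times p}$ satisfy $X^TX=I_p$, let $w^*\in\mathbb R^p$, $\sigma>0$ and $0<q<1$, and let $y=Xw^*+\xi$ with $\xi\sim\mathcal N(0,\sigma^2 I_n)$. Put $$\lambda_i:=\sigma\,\Phi^{-1}\Big(1-i\,\frac{q}{2p}\Big),\qquad i=1,\dots,p,$$ where $\Phi$ is the cumulative distribution function of the standard normal distribution. For $w\in\mathbb R^p$ let $|w|_{(1)}\ge\dots\ge|w|_{(p)}$ be the absolute values of its components in decreasing order, let $J_\lambda(w):=\sum_{i=1}^p\lambda_i|w|_{(i)}$ be the ordered $\ell_1$-norm, and let $J_\lambda^D(x):=\sup\{\langle x,v\rangle : v\in\mathbb R^p,\ J_\lambda(v)\le 1\}$ be its dual norm. Then the Ordered Dantzig Selector problem $$\min_{w\in\mathbb R^p} J_\lambda(w)\quad\text{subject to}\quad J_\lambda^D\big(X^T(y-Xw)\big)\le 1$$ has, for every value of $y \in \mathbb{R}^n$, a unique solution $\hat w$, and its false discovery rate satisfies $$\mathrm{FDR}=\mathbb E\left[\frac{V}{\max\{R,1\}}\right]\le q\cdot\frac{p_0}{p}\le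 q,$$ where $p_0:=|\{i:w^*_i=0\}|$, $V:=|\{i:w^*_i=0,\ \hat w_i\ne0\}|$ and $R:=|\{i:\hat w_i\neq 0\}|$. -/

import Mathlib

open MeasureTheory ProbabilityTheory
open scoped Matrix

noncomputable section

namespace ODS

/-- The entries `|w|_(1) ≥ … ≥ |w|_(p)`: `absSorted w i` is the `(i+1)`-st largest of the absolute
values `|w 0|, …, |w (p-1)|`, counted with multiplicity (sorting `-|w|` increasingly is sorting
`|w|` decreasingly). -/
def absSorted {p : ℕ} (w : Fin p → ℝ) (i : Fin p) : ℝ :=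
  |w (Tuple.sort (fun j => -|w j|) i)|

/-- The ordered `ℓ¹`-norm `J_λ(w) = ∑ λ_i |w|_(i)`. -/
def orderedL1 {p : ℕ} (lam w : Fin p → ℝ) : ℝ :=
  ∑ i, lam i * absSorted w i

/-- The dual norm `J_λ^D(x) = sup {⟨x, v⟩ : J_λ(v) ≤ 1}`. -/
def orderedL1Dual {p : ℕ} (lam x : Fin p → ℝ) : ℝ :=
  sSup ((fun v : Fin p → ℝ => x ⬝ᵥ v) '' {v | orderedL1 lam v ≤ 1})

/-- The feasible set `{w : J_λ^D(Xᵀ(y - Xw)) ≤ 1}` of the Ordered Dantzig Selector. -/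
def feasibleSet {n p : ℕ} (X : Matrix (Fin n) (Fin p) ℝ) (y : Fin n → ℝ) (lam : Fin p → ℝ) :
    Set (Fin p → ℝ) :=
  {w | orderedL1Dual lam (Xᵀ *ᵥ (y - X *ᵥ w)) ≤ 1}

/-- `w` solves the Ordered Dantzig Selector problem: it is feasible and minimizes `J_λ` over the
feasible set. -/
def IsSolution {n p : ℕ} (X : Matrix (Fin n) (Fin p) ℝ) (y : Fin n → ℝ) (lam w : Fin p → ℝ) :
    Prop :=
  w ∈ feasibleSet X y lam ∧ IsMinOn (orderedL1 lam) (feasibleSet X y lam) w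

/-- The quantile function `Φ⁻¹` of the standard normal distribution, for arguments in `(0, 1)`. -/
def normalQuantile (u : ℝ) : ℝ :=
  sInf {x : ℝ | u ≤ cdf (gaussianReal 0 1) x}

/-- The weights `λ_i = σ Φ⁻¹(1 - i q / (2p))`, `i = 1, …, p` (the index `i : Fin p` starts at 0). -/
def weights (p : ℕ) (σ q : ℝ) (i : Fin p) : ℝ :=
  σ * normalQuantile (1 - ((i : ℝ) + 1) * (q / (2 * (p : ℝ))))

/-- `p₀`, the number of true null hypotheses. -/
def numNull {p : ℕ} (wstar : Fin p → ℝ) : ℕ :=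
  (Finset.univ.filter fun i => wstar i = 0).card

/-- `V`, the number of false rejections. -/
def numFalse {p : ℕ} (wstar w : Fin p → ℝ) : ℕ :=
  (Finset.univ.filter fun i => wstar i = 0 ∧ w i ≠ 0).card

/-- `R`, the number of all rejections. -/
def numRejected {p : ℕ} (w : Fin p → ℝ) : ℕ :=
  (Finset.univ.filter fun i => w i ≠ 0).card

/-- The false discovery proportion `V / max(R, 1)`; its expectation is the FDR. -/
def fdp {p : ℕ} (wstar w : Fin p → ℝ) : ℝ :=
  (numFalse wstar w : ℝ) / max (numRejected w : ℝ) 1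

end ODS

end

/-! Put `z = Xᵀy`. Since `XᵀX = 1`, feasibility of `w` means that `z - w` lies in the dual ball,
which is described by the polyhedral inequalities of `dualBall`. Let `z - w` be the Euclidean
projection of `z` onto it. The variational inequality makes these inequalities tight on every
superlevel set of `|w|`, so `|w|` is weakly majorized by `|v|` for each feasible `v`
(`IsResidual.partialSum_le`). Summation by parts turns this into minimality of `J_λ`, and strict
decrease of the weights gives uniqueness (`IsResidual.eq_of_orderedL1_le`).

Tightness at level zero also shows that the support of `w` is the least maximizer of the excess `A ↦
∑_{i ∈ A} |z_i| - (λ_1 + ⋯ + λ_{|A|})` (`IsResidual.excess_le_support`). If `i` is a true null and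
the support is `A ∋ i`, then `|z_i| > λ_{|A|}`, and `A` is the least maximizer among the sets
containing `i`. Changing `z_i` shifts the excess of all those sets equally, so the second event is
independent of `z_i`. Its probability is thus multiplied by at most `|A| q / p`, which cancels the
`1 / |A|` in the false discovery proportion. The second events are disjoint for distinct `A`, so
each null contributes at most `q / p` (`sum_measure_div_card_le`). -/

noncomputable section

/-! ### Deterministic part: the solution as a projection residual, and its support. -/

namespace ODS

variable {p : ℕ}

/-! ### Summation by parts and sorting -/

/-- Extension of a finite sequence by zero. -/
def extendZero (f : Fin p → ℝ) (k : ℕ) : ℝ := if h : k < p then f ⟨k, h⟩ else 0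

@[simp]
lemma extendZero_val (f : Fin p → ℝ) (k : Fin p) : extendZero f k = f k := by
  simp [extendZero]

lemma extendZero_of_le (f : Fin p → ℝ) {k : ℕ} (h : p ≤ k) : extendZero f k = 0 := by
  simp [extendZero, h]

lemma extendZero_nonneg {f : Fin p → ℝ} (hf : ∀ i, 0 ≤ f i) (k : ℕ) : 0 ≤ extendZero f k := by
  unfold extendZero; split_ifs <;> simp [hf]

lemma antitone_extendZero {f : Fin p → ℝ} (hf : Antitone f) (h0 : ∀ i, 0 ≤ f i) :
    Antitone (extendZero f) := by
  intro a b hab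
  by_cases hb : b < p
  · have ha : a < p := hab.trans_lt hb
    simp only [extendZero, ha, hb, dif_pos]
    exact hf hab
  · rw [extendZero_of_le f (not_lt.1 hb)]
    exact extendZero_nonneg h0 a

/-- Partial sums `λ_1 + ⋯ + λ_m`. -/
def partialSum (f : Fin p → ℝ) (m : ℕ) : ℝ := ∑ k ∈ Finset.range m, extendZero f k

@[simp]
lemma partialSum_zero (f : Fin p → ℝ) : partialSum f 0 = 0 := by simp [partialSum]

lemma partialSum_succ (f : Fin p → ℝ) (m : ℕ) :
    partialSum f (m + 1) = partialSum f m + extendZero f m := by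
  simp [partialSum, Finset.sum_range_succ]

lemma monotone_partialSum {f : Fin p → ℝ} (h0 : ∀ i, 0 ≤ f i) : Monotone (partialSum f) :=
  monotone_nat_of_le_succ fun m => by
    rw [partialSum_succ]; linarith [extendZero_nonneg h0 m]

lemma sum_range_mul_eq_sum_sub_mul (a b : ℕ → ℝ) (n : ℕ) :
    ∑ k ∈ Finset.range n, b k * a k =
      ∑ k ∈ Finset.range n, (a k - a (k + 1)) * ∑ j ∈ Finset.range (k + 1), b j
        + a n * ∑ j ∈ Finset.range n, b j := by
  induction n with
  | zero => simp
  | succ n ih =>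
    rw [Finset.sum_range_succ, ih, Finset.sum_range_succ _ n]
    rw [Finset.sum_range_succ b n]; ring

/-- Summation by parts for finite sequences. -/
lemma sum_mul_eq_sum_sub_mul_partialSum (a b : Fin p → ℝ) :
    ∑ i, b i * a i = ∑ k ∈ Finset.range p,
      (extendZero a k - extendZero a (k + 1)) * partialSum b (k + 1) := by
  have h := sum_range_mul_eq_sum_sub_mul (extendZero a) (extendZero b) p
  rw [extendZero_of_le a le_rfl, zero_mul, add_zero] at h
  simp only [partialSum]
  rw [← h, ← Fin.sum_univ_eq_sum_range (fun k => extendZero b k * extendZero a k)]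
  simp

/-- The maximum of a set with `c + 1` elements is at least `c`, so removing it allows induction on
the set. -/
lemma sum_le_sum_range_card {f : ℕ → ℝ} (hf : Antitone f) (A : Finset ℕ) :
    ∑ k ∈ A, f k ≤ ∑ k ∈ Finset.range A.card, f k := by
  induction A using Finset.induction_on_max with
  | empty => simp
  | insert m A hm ih =>
    have hmA : m ∉ A := fun h => (hm m h).false
    rw [Finset.sum_insert hmA, Finset.card_insert_of_notMem hmA, Finset.sum_range_succ]
    have hc : A.card ≤ m := by
      calc A.card ≤ (Finset.range m).card :=
            Finset.card_le_card fun x hx => Finset.mem_range.2 (hm x hx)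
        _ = m := Finset.card_range m
    linarith [hf hc]

lemma sum_le_partialSum_card {f : Fin p → ℝ} (hf : Antitone f) (h0 : ∀ i, 0 ≤ f i)
    (A : Finset (Fin p)) : ∑ i ∈ A, f i ≤ partialSum f A.card := by
  have h := sum_le_sum_range_card (antitone_extendZero hf h0) (A.map Fin.valEmbedding)
  simpa [partialSum] using h

/-- The permutation sorting the absolute values decreasingly. -/
def sortPerm (w : Fin p → ℝ) : Equiv.Perm (Fin p) := Tuple.sort (fun j => -|w j|)

lemma absSorted_eq (w : Fin p → ℝ) (k : Fin p) : absSorted w k = |w (sortPerm w k)| := rfl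

lemma absSorted_symm (w : Fin p → ℝ) (i : Fin p) : absSorted w ((sortPerm w).symm i) = |w i| := by
  simp [absSorted_eq]

lemma absSorted_nonneg (w : Fin p → ℝ) (k : Fin p) : 0 ≤ absSorted w k := abs_nonneg _

lemma antitone_absSorted (w : Fin p → ℝ) : Antitone (absSorted w) := by
  intro a b hab
  have h := Tuple.monotone_sort (fun j => -|w j|) hab
  simpa [absSorted] using h

lemma antitone_extendZero_absSorted (w : Fin p → ℝ) : Antitone (extendZero (absSorted w)) :=
  antitone_extendZero (antitone_absSorted w) (absSorted_nonneg w)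

/-- The indices of the `m` largest absolute values. -/
def topSet (w : Fin p → ℝ) (m : ℕ) : Finset (Fin p) :=
  Finset.univ.filter fun i => ((sortPerm w).symm i : ℕ) < m

lemma sum_topSet (w : Fin p → ℝ) (f : Fin p → ℝ) {m : ℕ} (hm : m ≤ p) :
    ∑ i ∈ topSet w m, f i = partialSum (fun k => f (sortPerm w k)) m := by
  rw [topSet, Finset.sum_filter, ← Equiv.sum_comp (sortPerm w)]
  simp only [Equiv.symm_apply_apply]
  have h : ∀ k : Fin p, (if (k : ℕ) < m then f (sortPerm w k) else 0) =
      (fun k : ℕ => if k < m then extendZero (fun k => f (sortPerm w k)) k else 0) k := by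
    intro k; simp
  rw [Finset.sum_congr rfl fun k _ => h k, Fin.sum_univ_eq_sum_range
      (fun k : ℕ => if k < m then extendZero (fun k => f (sortPerm w k)) k else 0), partialSum,
    ← Finset.sum_filter]
  congr 1
  ext k; simp only [Finset.mem_filter, Finset.mem_range]; omega

lemma card_topSet (w : Fin p → ℝ) {m : ℕ} (hm : m ≤ p) : (topSet w m).card = m := by
  have h := sum_topSet w (fun _ => 1) hm
  have h2 : partialSum (fun _ : Fin p => (1 : ℝ)) m = m := by
    rw [partialSum, Finset.sum_congr rfl (g := fun _ => (1 : ℝ))]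
    · simp
    · intro k hk
      have : k < p := (Finset.mem_range.1 hk).trans_le hm
      simp [extendZero, this]
  rw [h2] at h
  simpa using h

lemma sum_comp_absSorted (w : Fin p → ℝ) (g : ℝ → ℝ) :
    ∑ k, g (absSorted w k) = ∑ i, g |w i| := by
  rw [← Equiv.sum_comp (sortPerm w) (fun i => g |w i|)]; rfl

/-! ### The unit ball of the dual norm -/

/-- The vectors whose `k` largest absolute values sum to at most `λ_1 + ⋯ + λ_k`, for each `k`. -/
def dualBall (lam : Fin p → ℝ) : Set (Fin p → ℝ) :=
  {u | ∀ A : Finset (Fin p), ∑ i ∈ A, |u i| ≤ partialSum lam A.card}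

lemma sum_abs_mul_abs_eq (u w : Fin p → ℝ) :
    ∑ i, |u i| * |w i| = ∑ k ∈ Finset.range p,
      (extendZero (absSorted w) k - extendZero (absSorted w) (k + 1)) *
        ∑ i ∈ topSet w (k + 1), |u i| := by
  rw [← Equiv.sum_comp (sortPerm w)]
  have h := sum_mul_eq_sum_sub_mul_partialSum (absSorted w) (fun k => |u (sortPerm w k)|)
  simp only [absSorted_eq] at h
  rw [h]
  refine Finset.sum_congr rfl fun k hk => ?_
  rw [sum_topSet w (fun i => |u i|) (Finset.mem_range.1 hk)]

lemma orderedL1_eq (lam w : Fin p → ℝ) :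
    orderedL1 lam w = ∑ k ∈ Finset.range p,
      (extendZero (absSorted w) k - extendZero (absSorted w) (k + 1)) * partialSum lam (k + 1) :=
  sum_mul_eq_sum_sub_mul_partialSum (absSorted w) lam

/-- After summation by parts along the order of `|w|`, both sides have the same nonnegative gaps as
coefficients, and the ball inequality for `topSet` compares them term by term. -/
lemma sum_abs_mul_abs_le_orderedL1 {lam u : Fin p → ℝ} (hu : u ∈ dualBall lam) (w : Fin p → ℝ) :
    ∑ i, |u i| * |w i| ≤ orderedL1 lam w := by
  rw [sum_abs_mul_abs_eq, orderedL1_eq]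
  refine Finset.sum_le_sum fun k hk => mul_le_mul_of_nonneg_left ?_ ?_
  · have := hu (topSet w (k + 1))
    rwa [card_topSet w (Finset.mem_range.1 hk)] at this
  · linarith [antitone_extendZero_absSorted w k.le_succ]

lemma dotProduct_le_sum_abs (u w : Fin p → ℝ) : u ⬝ᵥ w ≤ ∑ i, |u i| * |w i| :=
  Finset.sum_le_sum fun _ _ => (le_abs_self _).trans (abs_mul _ _).le

lemma dotProduct_le_orderedL1 {lam u : Fin p → ℝ} (hu : u ∈ dualBall lam) (w : Fin p → ℝ) :
    u ⬝ᵥ w ≤ orderedL1 lam w :=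
  (dotProduct_le_sum_abs u w).trans (sum_abs_mul_abs_le_orderedL1 hu w)

/-- The ordered norm is attained as a linear functional from the dual ball. -/
lemma exists_mem_dualBall_dotProduct_eq {lam : Fin p → ℝ} (hl : Antitone lam) (h0 : ∀ i, 0 ≤ lam i)
    (w : Fin p → ℝ) : ∃ c ∈ dualBall lam, c ⬝ᵥ w = orderedL1 lam w := by
  -- Each coordinate receives the weight of its rank in `|w|`, with the sign of `w`.
  refine ⟨fun i => lam ((sortPerm w).symm i) * SignType.sign (w i), fun A => ?_, ?_⟩
  · have h1 := sum_le_partialSum_card hl h0 (A.map (sortPerm w).symm.toEmbedding)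
    rw [Finset.sum_map, Finset.card_map] at h1
    refine le_trans (Finset.sum_le_sum fun i _ => ?_) h1
    rw [abs_mul, abs_of_nonneg (h0 _)]
    refine mul_le_of_le_one_right (h0 _) ?_
    rcases lt_trichotomy (w i) 0 with h | h | h <;> simp [h]
  · simp only [dotProduct, orderedL1]
    rw [← Equiv.sum_comp (sortPerm w)]
    refine Finset.sum_congr rfl fun k _ => ?_
    rw [mul_assoc, sign_mul_self, absSorted_eq, Equiv.symm_apply_apply]

/-- The dual norm is at most one exactly on `dualBall`. -/
lemma orderedL1Dual_le_one_iff {lam : Fin p → ℝ} (hp : 1 ≤ p) (hl : Antitone lam)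
    (h0 : ∀ i, 0 < lam i) (x : Fin p → ℝ) : orderedL1Dual lam x ≤ 1 ↔ x ∈ dualBall lam := by
  have h0' := fun i => (h0 i).le
  have hpos : ∀ A : Finset (Fin p), A.Nonempty →
      0 < partialSum lam 1 ∧ partialSum lam 1 ≤ partialSum lam A.card := by
    intro A hA
    refine ⟨?_, monotone_partialSum h0' (Finset.card_pos.2 hA)⟩
    have : 0 < p := hp
    simp [partialSum, extendZero, this, h0]
  constructor
  · intro hx A
    rcases A.eq_empty_or_nonempty with rfl | hA
    · simp
    obtain ⟨h1, h2⟩ := hpos A hA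
    have hS : 0 < partialSum lam A.card := h1.trans_le h2
    -- Without boundedness the real `sSup` would take the default value zero and say nothing. A
    -- small multiple of `x` lies in the dual ball, which bounds the pairing.
    have hbdd : BddAbove ((fun v : Fin p → ℝ => x ⬝ᵥ v) '' {v | orderedL1 lam v ≤ 1}) := by
      set M := ∑ i, |x i| with hM
      have hM0 : 0 ≤ M := Finset.sum_nonneg fun i _ => abs_nonneg _
      set ε := partialSum lam 1 / (M + 1) with hε
      have hε0 : 0 < ε := by positivity
      have hmem : ε • x ∈ dualBall lam := by
        intro B
        rcases B.eq_empty_or_nonempty with rfl | hB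
        · simp
        refine le_trans ?_ (hpos B hB).2
        simp only [Pi.smul_apply, smul_eq_mul, abs_mul, abs_of_pos hε0, ← Finset.mul_sum]
        have hBM : ∑ i ∈ B, |x i| ≤ M :=
          Finset.sum_le_sum_of_subset_of_nonneg (Finset.subset_univ B) fun i _ _ => abs_nonneg _
        calc ε * ∑ i ∈ B, |x i| ≤ ε * (M + 1) := by gcongr; linarith
          _ = partialSum lam 1 := by rw [hε]; field_simp
      refine ⟨ε⁻¹, ?_⟩
      rintro _ ⟨v, hv, rfl⟩
      have := (dotProduct_le_orderedL1 hmem v).trans hv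
      rw [smul_dotProduct, smul_eq_mul] at this
      change x ⬝ᵥ v ≤ ε⁻¹
      rwa [← one_div, le_div_iff₀ hε0, mul_comm]
    set S := partialSum lam A.card with hSdef
    -- This test vector of ordered norm at most one turns the dual norm bound into the inequality
    -- for `A`.
    set v : Fin p → ℝ := fun i => if i ∈ A then SignType.sign (x i) / S else 0 with hv
    have hvabs : ∀ i, |v i| ≤ if i ∈ A then S⁻¹ else 0 := by
      intro i
      simp only [hv]
      split_ifs
      · rw [abs_div, abs_of_pos hS, ← one_div]
        gcongr
        rcases lt_trichotomy (x i) 0 with h | h | h <;> simp [h]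
      · simp
    have hJv : orderedL1 lam v ≤ 1 := by
      obtain ⟨c, hc, hcv⟩ := exists_mem_dualBall_dotProduct_eq hl h0' v
      rw [← hcv]
      calc c ⬝ᵥ v ≤ ∑ i, |c i| * |v i| := dotProduct_le_sum_abs c v
        _ ≤ ∑ i, |c i| * (if i ∈ A then S⁻¹ else 0) :=
          Finset.sum_le_sum fun i _ => mul_le_mul_of_nonneg_left (hvabs i) (abs_nonneg _)
        _ = (∑ i ∈ A, |c i|) * S⁻¹ := by simp [Finset.sum_mul]
        _ ≤ S * S⁻¹ := by gcongr; exact hc A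
        _ = 1 := mul_inv_cancel₀ hS.ne'
    have hxv : x ⬝ᵥ v = (∑ i ∈ A, |x i|) / S := by
      simp only [dotProduct, hv, mul_ite, mul_zero, Finset.sum_ite_mem, Finset.univ_inter,
        Finset.sum_div]
      refine Finset.sum_congr rfl fun i _ => ?_
      rw [← mul_div_assoc, self_mul_sign]
    have := (le_csSup hbdd ⟨v, hJv, rfl⟩).trans hx
    simp only [hxv] at this
    rwa [div_le_one hS] at this
  · intro hx
    refine Real.sSup_le ?_ zero_le_one
    rintro _ ⟨v, hv, rfl⟩
    exact (dotProduct_le_orderedL1 hx v).trans hv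

/-! ### Projection onto the dual ball -/

lemma convex_dualBall (lam : Fin p → ℝ) : Convex ℝ (dualBall lam) := by
  intro u hu v hv a b ha hb hab A
  calc ∑ i ∈ A, |(a • u + b • v) i| ≤ ∑ i ∈ A, (a * |u i| + b * |v i|) := by
        refine Finset.sum_le_sum fun i _ => (abs_add_le _ _).trans_eq ?_
        simp [abs_mul, abs_of_nonneg ha, abs_of_nonneg hb]
    _ = a * ∑ i ∈ A, |u i| + b * ∑ i ∈ A, |v i| := by
        rw [Finset.sum_add_distrib, Finset.mul_sum, Finset.mul_sum]
    _ ≤ a * partialSum lam A.card + b * partialSum lam A.card := by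
        gcongr
        exacts [hu A, hv A]
    _ = partialSum lam A.card := by rw [← add_mul, hab, one_mul]

lemma isClosed_dualBall (lam : Fin p → ℝ) : IsClosed (dualBall lam) := by
  simp only [dualBall, Set.ofPred_forall]
  exact isClosed_iInter fun A => isClosed_le (by fun_prop) continuous_const

lemma zero_mem_dualBall {lam : Fin p → ℝ} (h0 : ∀ i, 0 ≤ lam i) : 0 ∈ dualBall lam := by
  intro A
  simpa using monotone_partialSum h0 (Nat.zero_le A.card)

/-- `z - w` is the Euclidean projection of `z` onto the dual ball. -/
def IsResidual (lam z w : Fin p → ℝ) : Prop :=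
  z - w ∈ dualBall lam ∧ ∀ c ∈ dualBall lam, c ⬝ᵥ w ≤ (z - w) ⬝ᵥ w

/-- The Hilbert projection theorem, applied in `EuclideanSpace` because the norm of `Fin p → ℝ` is
the sup norm. -/
lemma exists_isResidual {lam : Fin p → ℝ} (h0 : ∀ i, 0 ≤ lam i) (z : Fin p → ℝ) :
    ∃ w, IsResidual lam z w := by
  set K : Set (EuclideanSpace ℝ (Fin p)) := WithLp.ofLp ⁻¹' dualBall lam with hK
  have hKc : IsClosed K := (isClosed_dualBall lam).preimage (PiLp.continuous_ofLp 2 _)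
  have hKconv : Convex ℝ K := by
    intro u hu v hv a b ha hb hab
    exact convex_dualBall lam hu hv ha hb hab
  have hKne : K.Nonempty := ⟨0, zero_mem_dualBall h0⟩
  obtain ⟨u, hu, hmin⟩ :=
    exists_norm_eq_iInf_of_complete_convex hKne hKc.isComplete hKconv (WithLp.toLp 2 z)
  rw [norm_eq_iInf_iff_real_inner_le_zero hKconv hu] at hmin
  refine ⟨z - WithLp.ofLp u, ?_, fun c hc => ?_⟩
  · simpa [hK] using hu
  · have h := hmin (WithLp.toLp 2 c) hc
    simp only [EuclideanSpace.inner_eq_star_dotProduct, WithLp.ofLp_sub, star_trivial,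
      sub_dotProduct] at h
    simp only [sub_sub_cancel]
    linarith

variable {lam z w v : Fin p → ℝ}

/-- The projection maximizes the pairing with `w` over the dual ball, and that maximum is the
ordered norm. -/
lemma IsResidual.dotProduct_eq (hw : IsResidual lam z w) (hl : Antitone lam)
    (h0 : ∀ i, 0 ≤ lam i) : (z - w) ⬝ᵥ w = orderedL1 lam w := by
  obtain ⟨c, hc, hcw⟩ := exists_mem_dualBall_dotProduct_eq hl h0 w
  exact le_antisymm (dotProduct_le_orderedL1 hw.1 w) (hcw ▸ hw.2 c hc)

lemma IsResidual.sum_abs_mul_abs_eq (hw : IsResidual lam z w) (hl : Antitone lam)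
    (h0 : ∀ i, 0 ≤ lam i) : ∑ i, |(z - w) i| * |w i| = orderedL1 lam w :=
  le_antisymm (sum_abs_mul_abs_le_orderedL1 hw.1 w)
    ((hw.dotProduct_eq hl h0).symm.trans_le (dotProduct_le_sum_abs _ _))

/-- The residual and its complement have matching signs. -/
lemma IsResidual.abs_eq (hw : IsResidual lam z w) (hl : Antitone lam)
    (h0 : ∀ i, 0 ≤ lam i) (i : Fin p) : |z i| = |w i| + |(z - w) i| := by
  have h1 : ∑ i, (z - w) i * w i = ∑ i, |(z - w) i| * |w i| :=
    (hw.dotProduct_eq hl h0).trans (hw.sum_abs_mul_abs_eq hl h0).symm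
  have h2 := (Finset.sum_eq_sum_iff_of_le (s := Finset.univ) (f := fun i => (z - w) i * w i)
    (g := fun i => |(z - w) i| * |w i|)
    (fun i _ => (le_abs_self _).trans (abs_mul _ _).le)).1 h1 i (Finset.mem_univ i)
  simp only [← abs_mul] at h2
  have h3 : 0 ≤ (z - w) i * w i := h2 ▸ abs_nonneg _
  have h4 : z i = w i + (z - w) i := by simp
  rw [h4, abs_add_eq_add_abs_iff]
  rcases mul_nonneg_iff.1 h3 with h | h
  · exact Or.inl ⟨h.2, h.1⟩
  · exact Or.inr ⟨h.2, h.1⟩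

/-- The superlevel sets of `|w|` are tight for the projection `z - w`. -/
lemma IsResidual.sum_superlevel (hw : IsResidual lam z w) (hl : Antitone lam)
    (h0 : ∀ i, 0 ≤ lam i) {t : ℝ} (ht : 0 ≤ t) :
    ∑ i with t < |w i|, |(z - w) i| =
      partialSum lam (Finset.univ.filter fun i => t < |w i|).card := by
  classical
  -- The least such `m` counts the entries with `|w_i| > t`; the zero at index `p` is a witness
  -- because `t ≥ 0`.
  have hex : ∃ m, extendZero (absSorted w) m ≤ t := ⟨p, by rwa [extendZero_of_le _ le_rfl]⟩
  have hmp : Nat.find hex ≤ p := Nat.find_le (by rwa [extendZero_of_le _ le_rfl])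
  have hA : (Finset.univ.filter fun i => t < |w i|) = topSet w (Nat.find hex) := by
    ext i
    simp only [topSet, Finset.mem_filter, Finset.mem_univ, true_and, Nat.lt_find_iff, not_le]
    rw [← absSorted_symm w i, ← extendZero_val (absSorted w)]
    exact ⟨fun h m hm => h.trans_le (antitone_extendZero_absSorted w hm), fun h => h _ le_rfl⟩
  rw [hA, card_topSet w hmp]
  rcases h : Nat.find hex with _ | k
  · simp [topSet]
  · have hk : k < p := by omega
    have h1 : extendZero (absSorted w) (k + 1) ≤ t := h ▸ Nat.find_spec hex
    have h2 : t < extendZero (absSorted w) k := not_le.1 (Nat.find_min hex (by omega))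
    have h3 := hw.sum_abs_mul_abs_eq hl h0
    rw [ODS.sum_abs_mul_abs_eq, orderedL1_eq] at h3
    -- Equality of the sums forces equality of the terms; the gap at `k` straddles `t`, hence is
    -- positive and cancels.
    have h4 := (Finset.sum_eq_sum_iff_of_le (fun k hk => mul_le_mul_of_nonneg_left ?_ ?_)).1 h3 k
      (Finset.mem_range.2 hk)
    · exact mul_left_cancel₀ (by linarith) h4
    · have := hw.1 (topSet w (k + 1))
      rwa [card_topSet w (Finset.mem_range.1 hk)] at this
    · linarith [antitone_extendZero_absSorted w k.le_succ]

/-! ### Optimality and uniqueness -/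

/-- The hinge function `∑ (|w_i| - t)⁺`. -/
def hinge (w : Fin p → ℝ) (t : ℝ) : ℝ := ∑ i, max (|w i| - t) 0

lemma sum_sub_le_hinge (w : Fin p → ℝ) (t : ℝ) (A : Finset (Fin p)) :
    ∑ i ∈ A, (|w i| - t) ≤ hinge w t :=
  (Finset.sum_le_sum fun _ _ => le_max_left _ _).trans
    (Finset.sum_le_sum_of_subset_of_nonneg (Finset.subset_univ A) fun _ _ _ => le_max_right _ _)

lemma sum_abs_sub_partialSum_le (hv : z - v ∈ dualBall lam) (A : Finset (Fin p)) :
    ∑ i ∈ A, |z i| - partialSum lam A.card ≤ ∑ i ∈ A, |v i| := by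
  have h : ∑ i ∈ A, |z i| ≤ ∑ i ∈ A, (|v i| + |(z - v) i|) :=
    Finset.sum_le_sum fun i _ => by
      have := abs_add_le (v i) ((z - v) i)
      simpa using this
  rw [Finset.sum_add_distrib] at h
  linarith [hv A]

lemma IsResidual.sum_superlevel_abs (hw : IsResidual lam z w) (hl : Antitone lam)
    (h0 : ∀ i, 0 ≤ lam i) {t : ℝ} (ht : 0 ≤ t) :
    ∑ i with t < |w i|, |w i| = ∑ i with t < |w i|, |z i| -
      partialSum lam (Finset.univ.filter fun i => t < |w i|).card := by
  rw [← hw.sum_superlevel hl h0 ht, ← Finset.sum_sub_distrib]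
  exact Finset.sum_congr rfl fun i _ => by rw [hw.abs_eq hl h0 i]; ring

/-- On the superlevel set of `|w|` the residual removes as much of `|z|` as the ball allows, so no
feasible `v` has smaller mass there. -/
lemma IsResidual.hinge_le (hw : IsResidual lam z w) (hl : Antitone lam)
    (h0 : ∀ i, 0 ≤ lam i) (hv : z - v ∈ dualBall lam) {t : ℝ} (ht : 0 ≤ t) :
    hinge w t ≤ hinge v t := by
  have h1 : hinge w t = ∑ i with t < |w i|, (|w i| - t) := by
    rw [hinge, Finset.sum_filter]
    refine Finset.sum_congr rfl fun i _ => ?_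
    split_ifs with h
    · exact max_eq_left (by linarith)
    · exact max_eq_right (by linarith)
  refine le_trans ?_ (sum_sub_le_hinge v t (Finset.univ.filter fun i => t < |w i|))
  rw [h1, Finset.sum_sub_distrib, Finset.sum_sub_distrib, hw.sum_superlevel_abs hl h0 ht]
  gcongr
  exact sum_abs_sub_partialSum_le hv _

lemma partialSum_absSorted_eq_sum_topSet (w : Fin p → ℝ) {k : ℕ} (hk : k ≤ p) :
    partialSum (absSorted w) k = ∑ i ∈ topSet w k, |w i| := by
  rw [sum_topSet w (fun i => |w i|) hk]; rfl

lemma partialSum_absSorted_le (w : Fin p → ℝ) {k : ℕ} (hk : k ≤ p) (s : ℝ) :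
    partialSum (absSorted w) k ≤ k * s + hinge w s := by
  have h := sum_sub_le_hinge w s (topSet w k)
  rw [Finset.sum_sub_distrib, Finset.sum_const, card_topSet w hk, nsmul_eq_mul,
    ← partialSum_absSorted_eq_sum_topSet w hk] at h
  linarith

/-- This is the equality case of `partialSum_absSorted_le`; together they convert comparison of
hinges into majorization. For `k = p` the threshold is zero. -/
lemma partialSum_absSorted_eq (w : Fin p → ℝ) {k : ℕ} (hk : k ≤ p) :
    partialSum (absSorted w) k =
      k * extendZero (absSorted w) k + hinge w (extendZero (absSorted w) k) := by
  set s := extendZero (absSorted w) k with hs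
  have h : hinge w s = ∑ i ∈ topSet w k, (|w i| - s) := by
    rw [hinge, topSet, Finset.sum_filter]
    refine Finset.sum_congr rfl fun i _ => ?_
    rw [← absSorted_symm w i, ← extendZero_val (absSorted w)]
    split_ifs with h
    · exact max_eq_left (by linarith [antitone_extendZero_absSorted w h.le])
    · exact max_eq_right (by linarith [antitone_extendZero_absSorted w (not_lt.1 h)])
  rw [h, Finset.sum_sub_distrib, Finset.sum_const, card_topSet w hk, nsmul_eq_mul,
    ← partialSum_absSorted_eq_sum_topSet w hk]
  ring

/-- The residual is weakly majorized by every feasible vector. -/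
lemma IsResidual.partialSum_le (hw : IsResidual lam z w) (hl : Antitone lam)
    (h0 : ∀ i, 0 ≤ lam i) (hv : z - v ∈ dualBall lam) {k : ℕ} (hk : k ≤ p) :
    partialSum (absSorted w) k ≤ partialSum (absSorted v) k := by
  rw [partialSum_absSorted_eq v hk]
  refine (partialSum_absSorted_le w hk (extendZero (absSorted v) k)).trans ?_
  gcongr
  exact hw.hinge_le hl h0 hv (extendZero_nonneg (absSorted_nonneg v) k)

lemma orderedL1_eq_sum_partialSum_absSorted (lam w : Fin p → ℝ) :
    orderedL1 lam w = ∑ k ∈ Finset.range p,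
      (extendZero lam k - extendZero lam (k + 1)) * partialSum (absSorted w) (k + 1) := by
  rw [← sum_mul_eq_sum_sub_mul_partialSum]
  exact Finset.sum_congr rfl fun i _ => mul_comm _ _

lemma IsResidual.orderedL1_le (hw : IsResidual lam z w) (hl : Antitone lam)
    (h0 : ∀ i, 0 ≤ lam i) (hv : z - v ∈ dualBall lam) : orderedL1 lam w ≤ orderedL1 lam v := by
  rw [orderedL1_eq_sum_partialSum_absSorted, orderedL1_eq_sum_partialSum_absSorted]
  refine Finset.sum_le_sum fun k hk => mul_le_mul_of_nonneg_left ?_ ?_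
  · exact hw.partialSum_le hl h0 hv (Finset.mem_range.1 hk)
  · linarith [antitone_extendZero hl h0 k.le_succ]

/-- All gaps of the weights are positive, including the last one down to zero, so equal ordered
norms force equal sorted absolute values. Then `v` and `w` have the same Euclidean norm, and the
projection inequality `w ⬝ᵥ w ≤ v ⬝ᵥ w` gives `v = w`. -/
lemma IsResidual.eq_of_orderedL1_le (hw : IsResidual lam z w) (hl : StrictAnti lam)
    (h0 : ∀ i, 0 < lam i) (hv : z - v ∈ dualBall lam) (hvw : orderedL1 lam v ≤ orderedL1 lam w) :
    v = w := by
  have h0' := fun i => (h0 i).le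
  have heq := le_antisymm (hw.orderedL1_le hl.antitone h0' hv) hvw
  rw [orderedL1_eq_sum_partialSum_absSorted, orderedL1_eq_sum_partialSum_absSorted] at heq
  have hterm := (Finset.sum_eq_sum_iff_of_le (fun k hk => mul_le_mul_of_nonneg_left
    (hw.partialSum_le hl.antitone h0' hv (Finset.mem_range.1 hk))
    (by linarith [antitone_extendZero hl.antitone h0' k.le_succ]))).1 heq
  have hgap : ∀ k < p, extendZero lam k - extendZero lam (k + 1) ≠ 0 := by
    intro k hk
    have : extendZero lam (k + 1) < extendZero lam k := by
      by_cases hk1 : k + 1 < p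
      · simp only [extendZero, hk, hk1, dif_pos]
        exact hl (Nat.lt_succ_self k)
      · simp [extendZero, hk, hk1, h0]
    linarith
  have hsum : ∀ k ≤ p, partialSum (absSorted w) k = partialSum (absSorted v) k := by
    intro k hk
    rcases k with _ | k
    · simp
    · exact mul_left_cancel₀ (hgap k hk) (hterm k (Finset.mem_range.2 hk))
  have hsort : ∀ k, absSorted w k = absSorted v k := by
    intro k
    have h1 := hsum _ k.2
    rw [partialSum_succ, partialSum_succ, hsum k k.2.le] at h1
    simpa using h1
  have hsq : w ⬝ᵥ w = v ⬝ᵥ v := by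
    have h1 := sum_comp_absSorted w (fun x => x * x)
    have h2 := sum_comp_absSorted v (fun x => x * x)
    simp only [abs_mul_abs_self] at h1 h2
    simp only [dotProduct]
    rw [← h1, ← h2]
    exact Finset.sum_congr rfl fun k _ => by rw [hsort k]
  have hproj := hw.2 _ hv
  have h3 : (v - w) ⬝ᵥ (v - w) ≤ 0 := by
    simp only [sub_dotProduct, dotProduct_sub, dotProduct_comm w v] at hproj ⊢
    linarith
  have h4 : (v - w) ⬝ᵥ (v - w) = 0 :=
    le_antisymm h3 (Finset.sum_nonneg fun i _ => mul_self_nonneg _)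
  exact sub_eq_zero.1 (dotProduct_self_eq_zero.1 h4)

/-! ### The set of rejections -/

/-- The excess `∑_{i ∈ A} |z_i| - (λ_1 + ⋯ + λ_{|A|})`. -/
def excess (lam z : Fin p → ℝ) (A : Finset (Fin p)) : ℝ :=
  ∑ i ∈ A, |z i| - partialSum lam A.card

/-- The support of the residual is the least set of maximal excess. -/
lemma IsResidual.excess_le_support (hw : IsResidual lam z w) (hl : Antitone lam)
    (h0 : ∀ i, 0 ≤ lam i) (B : Finset (Fin p)) :
    excess lam z B ≤ excess lam z (Finset.univ.filter fun i => w i ≠ 0) ∧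
      (excess lam z B = excess lam z (Finset.univ.filter fun i => w i ≠ 0) →
        (Finset.univ.filter fun i => w i ≠ 0) ⊆ B) := by
  -- At level zero, the support has excess `∑ |w_i|`. Any `B` has excess at most `∑_{i ∈ B} |w_i|`,
  -- so equality requires `w` to vanish off `B`.
  have h1 := hw.sum_superlevel_abs hl h0 le_rfl
  simp only [abs_pos] at h1
  have h2 : ∑ i with w i ≠ 0, |w i| = ∑ i, |w i| := by
    rw [Finset.sum_filter]
    refine Finset.sum_congr rfl fun i _ => ?_
    split_ifs with h <;> simp_all
  have h3 := sum_abs_sub_partialSum_le hw.1 B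
  have h4 : ∑ i ∈ B, |w i| + ∑ i ∈ Bᶜ, |w i| = ∑ i, |w i| := Finset.sum_add_sum_compl B _
  have h5 : 0 ≤ ∑ i ∈ Bᶜ, |w i| := Finset.sum_nonneg fun i _ => abs_nonneg _
  simp only [excess]
  rw [← h1, h2]
  refine ⟨by linarith, fun h i hi => ?_⟩
  by_contra hiB
  have h6 : ∑ i ∈ Bᶜ, |w i| = 0 := by linarith
  rw [Finset.sum_eq_zero_iff_of_nonneg fun i _ => abs_nonneg _] at h6
  have := h6 i (Finset.mem_compl.2 hiB)
  simp_all

/-! ### Solutions for orthonormal designs -/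

lemma mem_feasibleSet_iff {n : ℕ} {X : Matrix (Fin n) (Fin p) ℝ} (hX : Xᵀ * X = 1) (hp : 1 ≤ p)
    (hl : Antitone lam) (h0 : ∀ i, 0 < lam i) (y : Fin n → ℝ) :
    w ∈ feasibleSet X y lam ↔ Xᵀ *ᵥ y - w ∈ dualBall lam := by
  rw [feasibleSet, Set.mem_ofPred_eq, orderedL1Dual_le_one_iff hp hl h0, Matrix.mulVec_sub,
    Matrix.mulVec_mulVec, hX, Matrix.one_mulVec]

lemma isSolution_iff_isResidual {n : ℕ} {X : Matrix (Fin n) (Fin p) ℝ} (hX : Xᵀ * X = 1)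
    (hp : 1 ≤ p) (hl : StrictAnti lam) (h0 : ∀ i, 0 < lam i) (y : Fin n → ℝ) :
    IsSolution X y lam w ↔ IsResidual lam (Xᵀ *ᵥ y) w := by
  have h0' := fun i => (h0 i).le
  have key : ∀ {w}, IsResidual lam (Xᵀ *ᵥ y) w → IsSolution X y lam w := by
    intro w hw
    refine ⟨(mem_feasibleSet_iff hX hp hl.antitone h0 y).2 hw.1, fun v hv => ?_⟩
    exact hw.orderedL1_le hl.antitone h0' ((mem_feasibleSet_iff hX hp hl.antitone h0 y).1 hv)
  refine ⟨fun hw => ?_, key⟩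
  obtain ⟨v, hv⟩ := exists_isResidual h0' (Xᵀ *ᵥ y)
  rwa [hv.eq_of_orderedL1_le hl h0 ((mem_feasibleSet_iff hX hp hl.antitone h0 y).1 hw.1)
    (hw.2 (key hv).1)]

lemma existsUnique_isSolution {n : ℕ} {X : Matrix (Fin n) (Fin p) ℝ} (hX : Xᵀ * X = 1)
    (hp : 1 ≤ p) (hl : StrictAnti lam) (h0 : ∀ i, 0 < lam i) (y : Fin n → ℝ) :
    ∃! w, IsSolution X y lam w := by
  simp only [isSolution_iff_isResidual hX hp hl h0]
  obtain ⟨v, hv⟩ := exists_isResidual (fun i => (h0 i).le) (Xᵀ *ᵥ y)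
  refine ⟨v, hv, fun w hw => hv.eq_of_orderedL1_le hl h0 hw.1 ?_⟩
  exact hw.orderedL1_le hl.antitone (fun i => (h0 i).le) hv.1

end ODS

end

/-! ### Probabilistic inputs: Gaussian tails, the law of `Xᵀξ`, and independence. -/

noncomputable section

namespace ODS

variable {p : ℕ}

/-! ### The standard normal quantile function and the weights -/

lemma continuous_cdf_of_null_singleton (μ : Measure ℝ) [IsProbabilityMeasure μ]
    (h : ∀ x, μ {x} = 0) : Continuous (cdf μ) := by
  refine continuous_iff_continuousAt.2 fun x => ?_
  rw [(monotone_cdf μ).continuousAt_iff_leftLim_eq_rightLim, (cdf μ).rightLim_eq]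
  refine le_antisymm ((monotone_cdf μ).leftLim_le le_rfl) ?_
  have h1 := (cdf μ).measure_singleton x
  rw [measure_cdf, h, eq_comm, ENNReal.ofReal_eq_zero] at h1
  linarith

lemma gaussianReal_singleton (x : ℝ) : gaussianReal 0 1 {x} = 0 := by
  have := nullSingletonClass_gaussianReal (μ := 0) one_ne_zero
  exact measure_singleton x

lemma continuous_cdf_gaussianReal : Continuous (cdf (gaussianReal 0 1)) :=
  continuous_cdf_of_null_singleton _ gaussianReal_singleton

lemma gaussianReal_real_Ioi (x : ℝ) :
    (gaussianReal 0 1).real (Set.Ioi x) = 1 - cdf (gaussianReal 0 1) x := by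
  rw [← Set.compl_Iic, probReal_compl_eq_one_sub measurableSet_Iic, cdf_eq_real]

lemma gaussianReal_real_Iio_neg (x : ℝ) :
    (gaussianReal 0 1).real (Set.Iio (-x)) = 1 - cdf (gaussianReal 0 1) x := by
  rw [← gaussianReal_real_Ioi]
  have h : (gaussianReal 0 1).map (fun x => -x) = gaussianReal 0 1 := by
    rw [gaussianReal_map_neg, neg_zero]
  rw [← h, map_measureReal_apply measurable_neg measurableSet_Iio, h]
  congr 1
  ext y; simp

lemma cdf_gaussianReal_zero : cdf (gaussianReal 0 1) 0 = 1 / 2 := by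
  have h1 := gaussianReal_real_Iio_neg 0
  have h2 : (gaussianReal 0 1).real (Set.Iio 0) = (gaussianReal 0 1).real (Set.Iic 0) := by
    have := nullSingletonClass_gaussianReal (μ := 0) one_ne_zero
    exact measureReal_congr Iio_ae_eq_Iic
  rw [neg_zero, h2, ← cdf_eq_real] at h1
  linarith

lemma cdf_normalQuantile {u : ℝ} (h0 : 0 < u) (h1 : u < 1) :
    cdf (gaussianReal 0 1) (normalQuantile u) = u := by
  set S : Set ℝ := {x : ℝ | u ≤ cdf (gaussianReal 0 1) x} with hS
  have hclosed : IsClosed S := isClosed_le continuous_const continuous_cdf_gaussianReal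
  have hne : S.Nonempty := by
    obtain ⟨x, hx⟩ := ((tendsto_cdf_atTop (gaussianReal 0 1)).eventually (lt_mem_nhds h1)).exists
    exact ⟨x, hx.le⟩
  have hbdd : BddBelow S := by
    obtain ⟨b, hb⟩ := ((tendsto_cdf_atBot (gaussianReal 0 1)).eventually (gt_mem_nhds h0)).exists
    refine ⟨b, fun x hx => ?_⟩
    by_contra hlt
    exact absurd ((hx.trans (monotone_cdf _ (not_le.1 hlt).le))) (not_le.2 hb)
  refine le_antisymm ?_ (hclosed.csInf_mem hne hbdd)
  -- Points left of the infimum have cdf below `u`, and continuity carries the bound to the infimum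
  -- itself.
  refine le_of_tendsto (f := cdf (gaussianReal 0 1))
    (x := nhdsWithin (normalQuantile u) (Set.Iio (normalQuantile u)))
    continuous_cdf_gaussianReal.continuousWithinAt ?_
  filter_upwards [self_mem_nhdsWithin] with x hx
  by_contra hlt
  exact absurd (csInf_le hbdd (show x ∈ S from (not_le.1 hlt).le)) (not_le.2 hx)

lemma normalQuantile_lt {u v : ℝ} (h0 : 0 < u) (huv : u < v) (h1 : v < 1) :
    normalQuantile u < normalQuantile v := by
  by_contra h
  have := monotone_cdf (gaussianReal 0 1) (not_lt.1 h)
  rw [cdf_normalQuantile h0 (huv.trans h1), cdf_normalQuantile (h0.trans huv) h1] at this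
  linarith

lemma normalQuantile_pos {u : ℝ} (h0 : 1 / 2 < u) (h1 : u < 1) : 0 < normalQuantile u := by
  by_contra h
  have := monotone_cdf (gaussianReal 0 1) (not_lt.1 h)
  rw [cdf_gaussianReal_zero, cdf_normalQuantile (by linarith) h1] at this
  linarith

lemma level_bounds {q : ℝ} (hq0 : 0 < q) (hq1 : q < 1) (i : Fin p) :
    1 / 2 < 1 - ((i : ℝ) + 1) * (q / (2 * (p : ℝ))) ∧
      1 - ((i : ℝ) + 1) * (q / (2 * (p : ℝ))) < 1 := by
  have hi : (i : ℝ) + 1 ≤ p := by exact_mod_cast i.2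
  have hi0 : (0 : ℝ) ≤ (i : ℝ) := Nat.cast_nonneg _
  have hp : (0 : ℝ) < p := by linarith
  have h1 : 0 < ((i : ℝ) + 1) * (q / (2 * (p : ℝ))) := by positivity
  have h2 : ((i : ℝ) + 1) * (q / (2 * (p : ℝ))) ≤ p * (q / (2 * (p : ℝ))) := by gcongr
  have h3 : p * (q / (2 * (p : ℝ))) = q / 2 := by field_simp
  constructor <;> linarith

lemma weights_pos {σ q : ℝ} (hσ : 0 < σ) (hq0 : 0 < q) (hq1 : q < 1) (i : Fin p) :
    0 < weights p σ q i :=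
  mul_pos hσ (normalQuantile_pos (level_bounds hq0 hq1 i).1 (level_bounds hq0 hq1 i).2)

lemma strictAnti_weights {σ q : ℝ} (hσ : 0 < σ) (hq0 : 0 < q) (hq1 : q < 1) :
    StrictAnti (weights p σ q) := by
  intro i j hij
  refine mul_lt_mul_of_pos_left (normalQuantile_lt ?_ ?_ (level_bounds hq0 hq1 i).2) hσ
  · linarith [(level_bounds hq0 hq1 j).1]
  · have hp : (0 : ℝ) < p := by exact_mod_cast i.pos
    have : (i : ℝ) < j := by exact_mod_cast hij
    gcongr

/-- A centred normal variable of standard deviation `σ` exceeds the `i`-th weight in absolute value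
with probability at most `i q / p`. -/
lemma gaussianReal_weights_lt_abs {σ q : ℝ} (hσ : 0 < σ) (hq0 : 0 < q) (hq1 : q < 1) (i : Fin p) :
    (gaussianReal 0 (σ ^ 2).toNNReal).real {x | weights p σ q i < |x|} ≤
      ((i : ℝ) + 1) * (q / p) := by
  have hmap : gaussianReal 0 (σ ^ 2).toNNReal = (gaussianReal 0 1).map (σ * ·) := by
    rw [gaussianReal_map_const_mul, mul_zero, mul_one]
    congr 1
    ext; simp [sq_nonneg]
  have hmeas : MeasurableSet {x : ℝ | weights p σ q i < |x|} :=
    measurableSet_lt measurable_const measurable_id.abs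
  rw [hmap, map_measureReal_apply (measurable_const_mul σ) hmeas]
  set s := normalQuantile (1 - ((i : ℝ) + 1) * (q / (2 * (p : ℝ)))) with hs
  have hsub : (σ * ·) ⁻¹' {x : ℝ | weights p σ q i < |x|} ⊆ Set.Ioi s ∪ Set.Iio (-s) := by
    intro x hx
    simp only [Set.mem_preimage, Set.mem_ofPred_eq, weights, abs_mul, abs_of_pos hσ] at hx
    have := lt_of_mul_lt_mul_left hx hσ.le
    rcases lt_abs.1 this with h | h
    · exact Or.inl h
    · exact Or.inr (by simp only [Set.mem_Iio]; linarith)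
  -- Two tails of mass `(i + 1) q / (2p)` each, which explains the factor 2 in the weights.
  refine (measureReal_mono hsub).trans ((measureReal_union_le _ _).trans_eq ?_)
  rw [gaussianReal_real_Ioi, gaussianReal_real_Iio_neg, hs, cdf_normalQuantile
    (by linarith [(level_bounds hq0 hq1 i).1]) (level_bounds hq0 hq1 i).2]
  have hp : (p : ℝ) ≠ 0 := by exact_mod_cast i.pos.ne'
  field_simp
  ring

/-! ### The law of the projected noise and independence of coordinates -/

/-- Moving `Xᵀ` across the inner product evaluates the Gaussian characteristic function at `Xt`, and
`X` preserves Euclidean norms. -/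
lemma charFun_map_mulVec_multivariateGaussian {n : ℕ} (X : Matrix (Fin n) (Fin p) ℝ)
    (hX : Xᵀ * X = 1) (σ : ℝ) (t : EuclideanSpace ℝ (Fin p)) :
    charFun ((multivariateGaussian 0 (σ ^ 2 • (1 : Matrix (Fin n) (Fin n) ℝ))).map
      (fun x => WithLp.toLp 2 (Xᵀ *ᵥ WithLp.ofLp x))) t =
      Complex.exp (-((σ ^ 2 * ∑ i, t i ^ 2 / 2 : ℝ) : ℂ)) := by
  have hS : (σ ^ 2 • (1 : Matrix (Fin n) (Fin n) ℝ)).PosSemidef :=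
    Matrix.PosSemidef.one.smul (sq_nonneg σ)
  have hinner : ∀ x : EuclideanSpace ℝ (Fin n),
      inner ℝ (WithLp.toLp 2 (Xᵀ *ᵥ WithLp.ofLp x)) t =
        inner ℝ x (WithLp.toLp 2 (X *ᵥ WithLp.ofLp t)) := by
    intro x
    simp only [EuclideanSpace.inner_eq_star_dotProduct, star_trivial]
    rw [Matrix.mulVec_transpose, dotProduct_comm, ← Matrix.dotProduct_mulVec, dotProduct_comm]
  rw [charFun_apply, integral_map (by fun_prop) (by fun_prop)]
  simp_rw [hinner]
  rw [← charFun_apply, charFun_multivariateGaussian hS]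
  congr 1
  have hdot : (X *ᵥ WithLp.ofLp t) ⬝ᵥ (X *ᵥ WithLp.ofLp t) = ∑ i, t i ^ 2 := by
    rw [Matrix.dotProduct_mulVec, ← Matrix.mulVec_transpose, Matrix.mulVec_mulVec, hX,
      Matrix.one_mulVec]
    simp [dotProduct, sq]
  simp only [inner_zero_right, Complex.ofReal_zero, zero_mul, zero_sub, Matrix.smul_mulVec,
    Matrix.one_mulVec, dotProduct_smul, smul_eq_mul, hdot, ← Finset.sum_div]
  push_cast
  ring

/-- For an orthonormal design the coordinates of `Xᵀ ξ` are independent centred normal variables. -/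
lemma map_mulVec_multivariateGaussian {n : ℕ} (X : Matrix (Fin n) (Fin p) ℝ)
    (hX : Xᵀ * X = 1) (σ : ℝ) :
    (multivariateGaussian 0 (σ ^ 2 • (1 : Matrix (Fin n) (Fin n) ℝ))).map
      (fun x => Xᵀ *ᵥ WithLp.ofLp x) =
      Measure.pi fun _ : Fin p => gaussianReal 0 (σ ^ 2).toNNReal := by
  have h : ((multivariateGaussian 0 (σ ^ 2 • (1 : Matrix (Fin n) (Fin n) ℝ))).map
      (fun x => WithLp.toLp 2 (Xᵀ *ᵥ WithLp.ofLp x))) =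
      (Measure.pi fun _ : Fin p => gaussianReal 0 (σ ^ 2).toNNReal).map (WithLp.toLp 2) := by
    have : IsProbabilityMeasure
        ((Measure.pi fun _ : Fin p => gaussianReal 0 (σ ^ 2).toNNReal).map (WithLp.toLp 2)) :=
      Measure.isProbabilityMeasure_map (by fun_prop)
    have : IsProbabilityMeasure
        ((multivariateGaussian 0 (σ ^ 2 • (1 : Matrix (Fin n) (Fin n) ℝ))).map
          (fun x => WithLp.toLp 2 (Xᵀ *ᵥ WithLp.ofLp x))) :=
      Measure.isProbabilityMeasure_map (by fun_prop)
    apply Measure.ext_of_charFun (E := EuclideanSpace ℝ (Fin p))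
    ext t
    rw [charFun_map_mulVec_multivariateGaussian X hX, charFun_pi]
    simp_rw [charFun_gaussianReal, ← Complex.exp_sum]
    congr 1
    simp only [Complex.ofReal_zero, mul_zero, zero_mul, zero_sub, Finset.sum_neg_distrib,
      Real.coe_toNNReal _ (sq_nonneg σ), Finset.mul_sum]
    push_cast
    congr 1
    exact Finset.sum_congr rfl fun i _ => by ring
  have h2 := congrArg (fun μ => Measure.map (WithLp.ofLp : EuclideanSpace ℝ (Fin p) → _) μ) h
  simp only at h2
  rw [Measure.map_map (by fun_prop) (by fun_prop), Measure.map_map (by fun_prop) (by fun_prop)] at h2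
  simpa [Function.comp_def] using h2

/-- The set `D` is its own preimage under resetting coordinate `i`, a map that depends only on the
other coordinates and is therefore independent of `x i`. -/
lemma pi_real_inter_of_update_invariant {ι : Type*} [Fintype ι] [DecidableEq ι] (μ : ι → Measure ℝ)
    [∀ i, IsProbabilityMeasure (μ i)] (i : ι) {s : Set ℝ} (hs : MeasurableSet s)
    {D : Set (ι → ℝ)} (hD : MeasurableSet D) (hup : ∀ x, Function.update x i 0 ∈ D ↔ x ∈ D) :
    (Measure.pi μ).real ({x | x i ∈ s} ∩ D) = (μ i).real s * (Measure.pi μ).real D := by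
  have hind : iIndepFun (fun (j : ι) (x : ι → ℝ) => x j) (Measure.pi μ) :=
    iIndepFun_pi (X := fun _ => id) fun _ => aemeasurable_id
  have h1 := hind.indepFun_finset {i} (Finset.univ.erase i) (by simp)
    (fun j => measurable_pi_apply j)
  have h2 : IndepFun (fun x : ι → ℝ => x i) (fun x => Function.update x i 0) (Measure.pi μ) := by
    have hφ : Measurable fun y : ({i} : Finset ι) → ℝ => y ⟨i, Finset.mem_singleton_self i⟩ :=
      measurable_pi_apply _
    have hψ : Measurable fun (y : ↥(Finset.univ.erase i) → ℝ) (j : ι) =>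
        if h : j ∈ Finset.univ.erase i then y ⟨j, h⟩ else 0 := by
      refine measurable_pi_lambda _ fun j => ?_
      by_cases h : j ∈ Finset.univ.erase i
      · simp only [h, dif_pos]
        exact measurable_pi_apply _
      · simp only [h, dif_neg, not_false_eq_true]
        exact measurable_const
    have h3 := h1.comp hφ hψ
    convert h3 using 1
    · rfl
    · funext x j
      by_cases h : j = i
      · subst h; simp
      · simp [h]
  have h4 := h2.measure_inter_preimage_eq_mul s D hs hD
  have h5 : (fun x : ι → ℝ => Function.update x i 0) ⁻¹' D = D := by
    ext x; exact hup x
  rw [h5] at h4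
  have h6 : (Measure.pi μ) ((fun x : ι → ℝ => x i) ⁻¹' s) = μ i s :=
    (measurePreserving_eval μ i).measure_preimage hs.nullMeasurableSet
  rw [h6] at h4
  simp only [Measure.real]
  rw [← ENNReal.toReal_mul, ← h4]
  rfl

end ODS

end

/-! ### The false discovery rate bound, by decomposition over possible supports. -/

noncomputable section

namespace ODS

variable {p : ℕ} {lam z w : Fin p → ℝ}

/-! ### Bounding the false discovery rate -/

/-- `A` is the least set of maximal excess. -/
def IsLeastMaximizer (lam z : Fin p → ℝ) (A : Finset (Fin p)) : Prop :=
  ∀ B, excess lam z B ≤ excess lam z A ∧ (excess lam z B = excess lam z A → A ⊆ B)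

/-- `A` is the least set of maximal excess among the sets containing `i`. -/
def IsLeastMaximizerAt (lam z : Fin p → ℝ) (i : Fin p) (A : Finset (Fin p)) : Prop :=
  ∀ B, i ∈ B → excess lam z B ≤ excess lam z A ∧ (excess lam z B = excess lam z A → A ⊆ B)

lemma IsLeastMaximizer.isLeastMaximizerAt {A : Finset (Fin p)} (h : IsLeastMaximizer lam z A) (i : Fin p) :
    IsLeastMaximizerAt lam z i A := fun B _ => h B

lemma IsLeastMaximizerAt.eq {i : Fin p} {A B : Finset (Fin p)} (hA : IsLeastMaximizerAt lam z i A)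
    (hB : IsLeastMaximizerAt lam z i B) (hiA : i ∈ A) (hiB : i ∈ B) : A = B := by
  have h := le_antisymm (hB A hiA).1 (hA B hiB).1
  exact ((hA B hiB).2 h.symm).antisymm ((hB A hiA).2 h)

lemma IsLeastMaximizer.eq {A B : Finset (Fin p)} (hA : IsLeastMaximizer lam z A)
    (hB : IsLeastMaximizer lam z B) : A = B := by
  have h := le_antisymm (hB A).1 (hA B).1
  exact ((hA B).2 h.symm).antisymm ((hB A).2 h)

/-- Members of the least maximizer `A` exceed the weight of index `|A|`. -/
lemma IsLeastMaximizer.lt_abs {A : Finset (Fin p)} (hA : IsLeastMaximizer lam z A) {i : Fin p}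
    (hi : i ∈ A) : extendZero lam (A.card - 1) < |z i| := by
  obtain ⟨h1, h2⟩ := hA (A.erase i)
  -- Strict because `A` is the least maximizer; the difference of the two excesses is `|z_i|` minus
  -- the weight of zero-based index `|A| - 1`.
  have hlt : excess lam z (A.erase i) < excess lam z A :=
    lt_of_le_of_ne h1 fun h => Finset.notMem_erase i A (h2 h hi)
  have hcard : A.card = (A.erase i).card + 1 := (Finset.card_erase_add_one hi).symm
  simp only [excess] at hlt
  rw [← Finset.add_sum_erase A _ hi, hcard, partialSum_succ] at hlt
  rw [hcard, Nat.add_sub_cancel]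
  linarith

/-- The shift is the same for every `B` containing `i`, so comparisons among such sets do not see
`z_i`. This is the source of independence. -/
lemma excess_update (lam z : Fin p → ℝ) {i : Fin p} (a : ℝ) {B : Finset (Fin p)} (hi : i ∈ B) :
    excess lam (Function.update z i a) B = excess lam z B + (|a| - |z i|) := by
  simp only [excess]
  rw [← Finset.add_sum_erase B _ hi, ← Finset.add_sum_erase B (fun j => |z j|) hi,
    Finset.sum_congr rfl (g := fun j => |z j|)]
  · simp only [Function.update_self]; ring
  · intro j hj
    rw [Function.update_of_ne (Finset.ne_of_mem_erase hj)]

lemma isLeastMaximizerAt_update_iff {i : Fin p} (a : ℝ) {A : Finset (Fin p)} (hi : i ∈ A) :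
    IsLeastMaximizerAt lam (Function.update z i a) i A ↔ IsLeastMaximizerAt lam z i A := by
  refine forall₂_congr fun B hB => ?_
  rw [excess_update lam z a hi, excess_update lam z a hB, add_le_add_iff_right, add_left_inj]

lemma measurable_excess (lam wstar : Fin p → ℝ) (A : Finset (Fin p)) :
    Measurable fun x => excess lam (wstar + x) A := by
  unfold excess
  fun_prop

lemma measurableSet_excess_comparison (lam wstar : Fin p → ℝ) (A B : Finset (Fin p)) :
    MeasurableSet {x | excess lam (wstar + x) B ≤ excess lam (wstar + x) A ∧
      (excess lam (wstar + x) B = excess lam (wstar + x) A → A ⊆ B)} := by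
  refine (measurableSet_le (measurable_excess lam wstar B) (measurable_excess lam wstar A)).inter ?_
  by_cases h : A ⊆ B
  · simp only [h, implies_true]
    exact MeasurableSet.univ
  · simp only [h, imp_false]
    exact (measurableSet_eq_fun (measurable_excess lam wstar B)
      (measurable_excess lam wstar A)).compl

lemma measurableSet_isLeastMaximizer (lam wstar : Fin p → ℝ) (A : Finset (Fin p)) :
    MeasurableSet {x | IsLeastMaximizer lam (wstar + x) A} := by
  simp only [IsLeastMaximizer, Set.ofPred_forall]
  exact MeasurableSet.iInter fun B => measurableSet_excess_comparison lam wstar A B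

lemma measurableSet_isLeastMaximizerAt (lam wstar : Fin p → ℝ) (i : Fin p) (A : Finset (Fin p)) :
    MeasurableSet {x | IsLeastMaximizerAt lam (wstar + x) i A} := by
  simp only [IsLeastMaximizerAt, Set.ofPred_forall]
  exact MeasurableSet.iInter fun B => MeasurableSet.iInter fun _ =>
    measurableSet_excess_comparison lam wstar A B

/-- The false discovery proportion as a function of the noise in the coefficients. -/
def nullProportion (lam wstar x : Fin p → ℝ) : ℝ :=
  ∑ i with wstar i = 0, ∑ A : Finset (Fin p) with i ∈ A,
    {x | IsLeastMaximizer lam (wstar + x) A}.indicator (fun _ => ((A.card : ℝ))⁻¹) x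

/-- Only the support `S` of `w` is a least maximizer, so the inner sum collapses to `1 / |S|` for
each null in `S`. -/
lemma fdp_eq_nullProportion {wstar x : Fin p → ℝ} (hw : IsResidual lam (wstar + x) w)
    (hl : Antitone lam) (h0 : ∀ i, 0 ≤ lam i) : fdp wstar w = nullProportion lam wstar x := by
  classical
  set S : Finset (Fin p) := Finset.univ.filter fun i => w i ≠ 0 with hS
  have hSmax : IsLeastMaximizer lam (wstar + x) S := fun B => hw.excess_le_support hl h0 B
  have hin : ∀ i, (∑ A : Finset (Fin p) with i ∈ A,
      {x | IsLeastMaximizer lam (wstar + x) A}.indicator (fun _ => ((A.card : ℝ))⁻¹) x) =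
      if i ∈ S then ((S.card : ℝ))⁻¹ else 0 := by
    intro i
    rw [Finset.sum_filter, Finset.sum_eq_single S]
    · split_ifs
      · exact Set.indicator_of_mem (by exact hSmax) _
      · rfl
    · intro A _ hA
      split_ifs
      · exact Set.indicator_of_notMem (fun h => hA (IsLeastMaximizer.eq h hSmax)) _
      · rfl
    · simp
  have hV : numFalse wstar w = ((Finset.univ.filter fun i => wstar i = 0).filter (· ∈ S)).card := by
    rw [numFalse, Finset.filter_filter]
    simp [hS]
  rw [nullProportion, Finset.sum_congr rfl fun i _ => hin i, ← Finset.sum_filter, Finset.sum_const,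
    nsmul_eq_mul, ← hV, fdp, div_eq_mul_inv]
  -- With no rejections both sides vanish because `V = 0`; otherwise the maximum with 1 has no
  -- effect.
  rcases Nat.eq_zero_or_pos S.card with h | h
  · have hV0 : numFalse wstar w = 0 := by
      rw [hV, Finset.card_eq_zero.1 h]; simp
    simp [hV0]
  · have hR : numRejected w = S.card := rfl
    rw [hR, max_eq_left (by exact_mod_cast h)]

lemma integrable_indicator_isLeastMaximizer (Q : Measure (Fin p → ℝ)) [IsFiniteMeasure Q]
    (lam wstar : Fin p → ℝ) (A : Finset (Fin p)) (c : ℝ) :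
    Integrable ({x | IsLeastMaximizer lam (wstar + x) A}.indicator fun _ => c) Q :=
  (integrable_const c).indicator (measurableSet_isLeastMaximizer lam wstar A)

lemma integrable_nullProportion (Q : Measure (Fin p → ℝ)) [IsFiniteMeasure Q]
    (lam wstar : Fin p → ℝ) : Integrable (nullProportion lam wstar) Q :=
  integrable_finsetSum _ fun _ _ => integrable_finsetSum _ fun A _ =>
    integrable_indicator_isLeastMaximizer Q lam wstar A _

/-- Each true null contributes at most `α` to the false discovery rate, if its coordinate exceeds
the `k`-th weight with probability at most `k α`. -/
lemma sum_measure_div_card_le (μ : Fin p → Measure ℝ) [∀ i, IsProbabilityMeasure (μ i)]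
    (lam wstar : Fin p → ℝ) {i : Fin p} (hi : wstar i = 0) {α : ℝ} (hα : 0 ≤ α)
    (htail : ∀ k : Fin p, (μ i).real {x | lam k < |x|} ≤ ((k : ℝ) + 1) * α) :
    ∑ A : Finset (Fin p) with i ∈ A,
      (Measure.pi μ).real {x | IsLeastMaximizer lam (wstar + x) A} * ((A.card : ℝ))⁻¹ ≤ α := by
  classical
  set D : Finset (Fin p) → Set (Fin p → ℝ) :=
    fun A => {x | IsLeastMaximizerAt lam (wstar + x) i A} with hD
  have hDmeas : ∀ A, MeasurableSet (D A) := measurableSet_isLeastMaximizerAt lam wstar i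
  have hterm : ∀ A : Finset (Fin p), i ∈ A →
      (Measure.pi μ).real {x | IsLeastMaximizer lam (wstar + x) A} * ((A.card : ℝ))⁻¹ ≤
        α * (Measure.pi μ).real (D A) := by
    intro A hiA
    have hcard : 0 < A.card := Finset.card_pos.2 ⟨i, hiA⟩
    have hlt : A.card - 1 < p := by
      have := A.card_le_univ
      simp only [Fintype.card_fin] at this
      omega
    set k : Fin p := ⟨A.card - 1, hlt⟩ with hk
    have hkc : (k : ℝ) + 1 = A.card := by
      have : (k : ℕ) + 1 = A.card := by simp only [hk]; omega
      exact_mod_cast this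
    -- The first factor involves only the noise `x i`, since `wstar i = 0`; the second is unaffected
    -- by it.
    have hsub : {x | IsLeastMaximizer lam (wstar + x) A} ⊆
        {x | x i ∈ {y : ℝ | lam k < |y|}} ∩ D A := by
      intro x hx
      have hx' : IsLeastMaximizer lam (wstar + x) A := hx
      refine ⟨?_, hx'.isLeastMaximizerAt i⟩
      have h := hx'.lt_abs hiA
      rw [show A.card - 1 = ((k : Fin p) : ℕ) from rfl, extendZero_val] at h
      simpa [hi] using h
    have hup : ∀ x, Function.update x i 0 ∈ D A ↔ x ∈ D A := by
      intro x
      have hupd : wstar + Function.update x i 0 = Function.update (wstar + x) i 0 := by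
        ext j
        by_cases hj : j = i
        · subst hj; simp [hi]
        · simp [hj]
      change IsLeastMaximizerAt lam (wstar + Function.update x i 0) i A ↔ _
      rw [hupd, isLeastMaximizerAt_update_iff 0 hiA]
      rfl
    have hmul := pi_real_inter_of_update_invariant μ i
      (measurableSet_lt measurable_const measurable_id.abs : MeasurableSet {y : ℝ | lam k < |y|})
      (hDmeas A) hup
    have hc : (0 : ℝ) < A.card := by exact_mod_cast hcard
    rw [← div_eq_mul_inv, div_le_iff₀ hc]
    calc (Measure.pi μ).real {x | IsLeastMaximizer lam (wstar + x) A}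
        ≤ (μ i).real {y : ℝ | lam k < |y|} * (Measure.pi μ).real (D A) :=
          hmul ▸ measureReal_mono hsub
      _ ≤ (((k : ℝ) + 1) * α) * (Measure.pi μ).real (D A) := by
          gcongr
          exact htail k
      _ = α * (Measure.pi μ).real (D A) * A.card := by rw [hkc]; ring
  refine (Finset.sum_le_sum fun A hA => hterm A (Finset.mem_filter.1 hA).2).trans ?_
  rw [← Finset.mul_sum]
  refine mul_le_of_le_one_right hα ?_
  -- The events `D A` with `i ∈ A` are disjoint by uniqueness of the least maximizer, so their
  -- probabilities sum to at most one.
  rw [← measureReal_biUnion_finset _ fun A _ => hDmeas A]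
  · exact measureReal_le_one
  · intro A hA B hB hAB
    refine Set.disjoint_left.2 fun x hxA hxB => hAB ?_
    exact IsLeastMaximizerAt.eq hxA hxB (by simpa using hA) (by simpa using hB)

lemma integral_nullProportion_le (μ : Fin p → Measure ℝ) [∀ i, IsProbabilityMeasure (μ i)]
    (lam wstar : Fin p → ℝ) {α : ℝ} (hα : 0 ≤ α)
    (htail : ∀ i, wstar i = 0 → ∀ k : Fin p,
      (μ i).real {x | lam k < |x|} ≤ ((k : ℝ) + 1) * α) :
    ∫ x, nullProportion lam wstar x ∂(Measure.pi μ) ≤ numNull wstar * α := by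
  have hint := integrable_indicator_isLeastMaximizer (Measure.pi μ) lam wstar
  simp only [nullProportion]
  rw [integral_finsetSum _ fun i _ => integrable_finsetSum _ fun A _ => hint A _]
  simp_rw [integral_finsetSum _ fun A _ => hint A _]
  rw [numNull, ← nsmul_eq_mul]
  refine Finset.sum_le_card_nsmul _ _ _ fun i hi => ?_
  have hi' : wstar i = 0 := (Finset.mem_filter.1 hi).2
  refine le_of_eq_of_le (Finset.sum_congr rfl fun A _ => ?_)
    (sum_measure_div_card_le μ lam wstar hi' hα (htail i hi'))
  rw [integral_indicator_const _ (measurableSet_isLeastMaximizer lam wstar A), smul_eq_mul]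

end ODS

end

/-! ### Assembly of the theorem. -/

theorem theorem3 {n p : ℕ} (hp : 1 ≤ p) (X : Matrix (Fin n) (Fin p) ℝ) (hX : Xᵀ * X = 1)
    (wstar : Fin p → ℝ) (σ q : ℝ) (hσ : 0 < σ) (hq0 : 0 < q) (hq1 : q < 1)
    {Ω : Type*} [MeasurableSpace Ω] (P : Measure Ω) [IsProbabilityMeasure P]
    (ξ : Ω → EuclideanSpace ℝ (Fin n))
    (hξ : HasLaw ξ (multivariateGaussian 0 (σ ^ 2 • (1 : Matrix (Fin n) (Fin n) ℝ))) P) :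
    (∀ y : Fin n → ℝ, ∃! w : Fin p → ℝ, ODS.IsSolution X y (ODS.weights p σ q) w) ∧
    ∀ what : Ω → Fin p → ℝ,
      (∀ ω, ODS.IsSolution X (X *ᵥ wstar + WithLp.ofLp (ξ ω)) (ODS.weights p σ q) (what ω)) →
      Integrable (fun ω => ODS.fdp wstar (what ω)) P ∧
      ∫ ω, ODS.fdp wstar (what ω) ∂P ≤ q * ((ODS.numNull wstar : ℝ) / (p : ℝ)) ∧
      q * ((ODS.numNull wstar : ℝ) / (p : ℝ)) ≤ q := by
  have hanti := ODS.strictAnti_weights (p := p) hσ hq0 hq1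
  have hpos := ODS.weights_pos (p := p) hσ hq0 hq1
  have hp0 : (0 : ℝ) < p := by exact_mod_cast hp
  refine ⟨ODS.existsUnique_isSolution hX hp hanti hpos, fun what hwhat => ?_⟩
  -- The proportion is a fixed function of `Xᵀξ` at every `ω`, so integrability needs no
  -- measurability of `what`.
  have hfdp : (fun ω => ODS.fdp wstar (what ω)) = fun ω =>
      ODS.nullProportion (ODS.weights p σ q) wstar (Xᵀ *ᵥ WithLp.ofLp (ξ ω)) := by
    ext ω
    refine ODS.fdp_eq_nullProportion ?_ hanti.antitone fun i => (hpos i).le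
    have h := (ODS.isSolution_iff_isResidual hX hp hanti hpos _).1 (hwhat ω)
    rwa [Matrix.mulVec_add, Matrix.mulVec_mulVec, hX, Matrix.one_mulVec] at h
  have hmulVec : Measurable fun x : EuclideanSpace ℝ (Fin n) => Xᵀ *ᵥ WithLp.ofLp x := by fun_prop
  have hmeas : AEMeasurable (fun ω => Xᵀ *ᵥ WithLp.ofLp (ξ ω)) P :=
    hmulVec.comp_aemeasurable hξ.aemeasurable
  have hlaw : P.map (fun ω => Xᵀ *ᵥ WithLp.ofLp (ξ ω)) =
      Measure.pi fun _ : Fin p => gaussianReal 0 (σ ^ 2).toNNReal := by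
    rw [← ODS.map_mulVec_multivariateGaussian X hX σ, ← hξ.map_eq,
      AEMeasurable.map_map_of_aemeasurable (by fun_prop) hξ.aemeasurable]
    rfl
  have hint := ODS.integrable_nullProportion
    (Measure.pi fun _ : Fin p => gaussianReal 0 (σ ^ 2).toNNReal) (ODS.weights p σ q) wstar
  rw [hfdp]
  refine ⟨?_, ?_, ?_⟩
  · rw [← hlaw] at hint
    exact hint.comp_aemeasurable hmeas
  · rw [← integral_map (f := ODS.nullProportion (ODS.weights p σ q) wstar) hmeas
      (by rw [hlaw]; exact hint.aestronglyMeasurable), hlaw]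
    refine (ODS.integral_nullProportion_le _ (ODS.weights p σ q) wstar (α := q / p)
      (by positivity) fun i _ k => ODS.gaussianReal_weights_lt_abs hσ hq0 hq1 k).trans_eq ?_
    ring
  · refine mul_le_of_le_one_right hq0.le ((div_le_one hp0).2 ?_)
    have : ODS.numNull wstar ≤ p := (Finset.card_le_univ _).trans_eq (Fintype.card_fin p)
    exact_mod_cast this
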